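/- Let $X_1,X_2,X_3\subset\mathbb{R}^d$ be compact and let $\mu_i$ be a Borel probability measure on $\mathbb{R}^d$ concentrated on $X_i$ ($i=1,2,3$). For probability measures $\mu,\nu$ with compact support write $\mu\preceq_c\nu$ if $\int\varphi\,d\mu\le\int\varphi\,d\nu$ for every convex $\varphi:\mathbb{R}^d\to\mathbb{R}$. Let $\Pi_M(\mu_1,\mu_j)$ be the set of couplings $\pi=\mu_1\otimes\kappa$ of $\mu_1$ and $\mu_j$ with $\int y\,\kappa(x_1,dy)=x_1$ for $\mu_1$-a.e. $x_1$, and let $\Pi_M(\mu_1,\mu_2,\mu_3)$ be the set of couplings $\pi$ of $\mu_1,\mu_2,\mu_3$ whose disintegrations $\pi=\mu_1\otimes\kappa_1^{23}=\mathrm{Proj}_{12}(\pi)\otimes\kappa_{12}^3$ satisfy $\int x_2\,\kappa_1^{23}(x_1,dx_2,dx_3)=x_1$ for $\mu_1$-a.e. $x_1$ and $\int x_3\,\kappa_{12}^3(x_1,x_2,dx_3)=x_2$ for $\mathrm{Proj}_{12}(\pi)$-a.e. $(x_1,x_2)$. Suppose that $\mu_1\preceq_c\mu_2\preceq_c\mu_3$,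 and let $\pi^{12}=\mu_1\otimes\kappa_1^2\in\Pi_M(\mu_1,\mu_2)$ and $\pi^{13}=\mu_1\otimes\kappa_1^3\in\Pi_M(\mu_1,\mu_3)$, with probability kernels $\kappa_1^2,\kappa_1^3$, be such that $\kappa_1^2(x_1,\cdot)\preceq_c\kappa_1^3(x_1,\cdot)$ for $\mu_1$-a.e. $x_1$. Then there exists $\pi^{123}\in\Pi_M(\mu_1,\mu_2,\mu_3)$ such that $$\mathrm{Proj}_{12}(\pi^{123})=\pi^{12},\qquad \mathrm{Proj}_{13}(\pi^{123})=\pi^{13}.$$ -/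

import Mathlib

open MeasureTheory ProbabilityTheory

namespace MartingaleOT

/-- The Euclidean space `ℝ^d`. -/
abbrev Rd (d : ℕ) : Type := EuclideanSpace ℝ (Fin d)

/-- The convex order `μ ⪯_c ν`: `∫ φ dμ ≤ ∫ φ dν` for every convex `φ : ℝ^d → ℝ`.
It is used for probability measures that are concentrated on compact sets; every such `φ` is
continuous, hence integrable against them. -/
def ConvexOrder {d : ℕ} (μ ν : Measure (Rd d)) : Prop :=
  ∀ φ : Rd d → ℝ, ConvexOn ℝ Set.univ φ → ∫ x, φ x ∂μ ≤ ∫ x, φ x ∂ν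

/-- `Proj_{12}` of a measure on triples `(x₁, x₂, x₃)`. -/
noncomputable def proj12 {d : ℕ} (π : Measure (Rd d × Rd d × Rd d)) : Measure (Rd d × Rd d) :=
  π.map (fun x => (x.1, x.2.1))

/-- `Proj_{13}` of a measure on triples `(x₁, x₂, x₃)`. -/
noncomputable def proj13 {d : ℕ} (π : Measure (Rd d × Rd d × Rd d)) : Measure (Rd d × Rd d) :=
  π.map (fun x => (x.1, x.2.2))

/-- `π ∈ Π(μ₁, μ₂)`. -/
def IsCoupling₂ {d : ℕ} (μ₁ μ₂ : Measure (Rd d)) (π : Measure (Rd d × Rd d)) : Prop :=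
  π.map (fun x => x.1) = μ₁ ∧ π.map (fun x => x.2) = μ₂

/-- `π ∈ Π(μ₁, μ₂, μ₃)`. -/
def IsCoupling₃ {d : ℕ} (μ₁ μ₂ μ₃ : Measure (Rd d))
    (π : Measure (Rd d × Rd d × Rd d)) : Prop :=
  π.map (fun x => x.1) = μ₁ ∧ π.map (fun x => x.2.1) = μ₂ ∧ π.map (fun x => x.2.2) = μ₃

/-- `π ∈ Π_M(μ₁, μ₂)`: a coupling whose disintegration `π = μ₁ ⊗ κ` satisfies
`∫ x₂ κ(x₁, dx₂) = x₁` for `μ₁`-a.e. `x₁`. (Disintegrations are unique up to `μ₁`-null sets.) -/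
def IsMartingaleCoupling₂ {d : ℕ} (μ₁ μ₂ : Measure (Rd d)) (π : Measure (Rd d × Rd d)) : Prop :=
  IsCoupling₂ μ₁ μ₂ π ∧
  ∃ κ : Kernel (Rd d) (Rd d), IsMarkovKernel κ ∧ π = μ₁ ⊗ₘ κ ∧
    ∀ᵐ x₁ ∂μ₁, Integrable (fun x₂ => x₂) (κ x₁) ∧ ∫ x₂, x₂ ∂(κ x₁) = x₁

/-- `π ∈ Π_M(μ₁, μ₂, μ₃)`: a coupling such that, for the disintegrations `π = μ₁ ⊗ κ` with respect
to `x₁` and `π = Proj_{12}(π) ⊗ η` with respect to `(x₁, x₂)`, one has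
`∫ x₂ κ(x₁, d(x₂, x₃)) = x₁` for `μ₁`-a.e. `x₁` and
`∫ x₃ η(x₁, x₂, dx₃) = x₂` for `Proj_{12}(π)`-a.e. `(x₁, x₂)`. -/
def IsMartingaleCoupling₃ {d : ℕ} (μ₁ μ₂ μ₃ : Measure (Rd d))
    (π : Measure (Rd d × Rd d × Rd d)) : Prop :=
  IsCoupling₃ μ₁ μ₂ μ₃ π ∧
  (∃ κ : Kernel (Rd d) (Rd d × Rd d), IsMarkovKernel κ ∧ π = μ₁ ⊗ₘ κ ∧
    ∀ᵐ x₁ ∂μ₁, Integrable (fun y => y.1) (κ x₁) ∧ ∫ y, y.1 ∂(κ x₁) = x₁) ∧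
  (∃ η : Kernel (Rd d × Rd d) (Rd d), IsMarkovKernel η ∧
    π.map (fun x => ((x.1, x.2.1), x.2.2)) = proj12 π ⊗ₘ η ∧
    ∀ᵐ p ∂(proj12 π), Integrable (fun x₃ => x₃) (η p) ∧ ∫ x₃, x₃ ∂(η p) = p.2)

end MartingaleOT

namespace MartingaleOT

open scoped BoundedContinuousFunction RealInnerProductSpace ContDiff

/-! The gluing is a linear feasibility problem on the compact set `X₁ × X₂ × X₃`: find a positive
measure giving `u(x₁,x₂) + v(x₁,x₃) + ⟪g(x₁,x₂), x₃ - x₂⟫` the integral `∫ u dπ₁₂ + ∫ v dπ₁₃` for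
all bounded continuous `u`, `v`, `g`. By Riesz extension and Riesz–Markov
(`exists_measure_integral_eq`), it suffices that this value is nonnegative whenever the function is
nonnegative on the compact set. That is checked for each fixed `x₁`, where a supremum of affine
functions supplies a convex function to test the order of the two kernels
(`integral_add_integral_nonneg_of_convexOrder`). Working with the joint law avoids a measurable
selection of Strassen kernels in `x₁`. -/

/-- A linear functional on `V` that is nonnegative on the preimage under `T` of the nonnegative
continuous functions on a compact space is integration along `T` against a finite measure. -/
theorem exists_measure_integral_eq {V K : Type*} [AddCommGroup V] [Module ℝ V]
    [TopologicalSpace K] [CompactSpace K] [T2Space K] [MeasurableSpace K] [BorelSpace K]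
    (T : V →ₗ[ℝ] C(K, ℝ)) (L : V →ₗ[ℝ] ℝ) (v₁ : V) (hv₁ : ∀ x, T v₁ x = 1)
    (hpos : ∀ v, (∀ x, 0 ≤ T v x) → 0 ≤ L v) :
    ∃ μ : Measure K, IsFiniteMeasure μ ∧ ∀ v, ∫ x, T v x ∂μ = L v := by
  -- Positivity at both `v` and `-v` kills `L` on the kernel, so `L` descends to the range of `T`.
  have hker : LinearMap.ker T ≤ LinearMap.ker L := by
    intro v hv
    rw [LinearMap.mem_ker] at hv ⊢
    refine le_antisymm ?_ (hpos v fun x => by simp [hv])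
    have := hpos (-v) fun x => by simp [hv]
    simpa using this
  let f : C(K, ℝ) →ₗ.[ℝ] ℝ :=
    ⟨LinearMap.range T, ((LinearMap.ker T).liftQ L hker).comp T.quotKerEquivRange.symm.toLinearMap⟩
  have hf : ∀ v, f ⟨T v, LinearMap.mem_range_self T v⟩ = L v := by
    intro v
    change (LinearMap.ker T).liftQ L hker (T.quotKerEquivRange.symm ⟨T v, _⟩) = L v
    rw [LinearMap.quotKerEquivRange_symm_apply_image T v (LinearMap.mem_range_self T v)]
    simp
  obtain ⟨g, hg, hgpos⟩ := riesz_extension (PointedCone.positive ℝ C(K, ℝ)) f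
    (by
      rintro ⟨_, v, rfl⟩ hv
      rw [hf]
      exact hpos v fun x => hv x)
    (by
      intro y
      -- The range contains the constants, and `‖y‖ + y ≥ 0`.
      refine ⟨⟨T (‖y‖ • v₁), LinearMap.mem_range_self T _⟩, ?_⟩
      rw [PointedCone.mem_positive]
      intro x
      have h1 : |y x| ≤ ‖y‖ := y.norm_coe_le_norm x
      have h2 := (abs_le.1 h1).1
      have h3 : T (‖y‖ • v₁) x = ‖y‖ := by simp [hv₁]
      change 0 ≤ T (‖y‖ • v₁) x + y x
      linarith)
  let Λ₀ : CompactlySupportedContinuousMap K ℝ →ₗ[ℝ] ℝ :=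
    { toFun := fun u => g (u : C(K, ℝ))
      map_add' := fun u v => g.map_add (u : C(K, ℝ)) (v : C(K, ℝ))
      map_smul' := fun c u => g.map_smul c (u : C(K, ℝ)) }
  let Λ := PositiveLinearMap.mk₀ Λ₀ fun u hu => hgpos (u : C(K, ℝ)) hu
  refine ⟨RealRMK.rieszMeasure Λ, inferInstance, fun v => ?_⟩
  have := RealRMK.integral_rieszMeasure Λ (CompactlySupportedContinuousMap.continuousMapEquiv (T v))
  refine this.trans ((?_ : _ = g (T v)).trans ((hg ⟨T v, LinearMap.mem_range_self T v⟩).trans (hf v)))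
  rfl

variable {E : Type*} [NormedAddCommGroup E] [InnerProductSpace ℝ E] [FiniteDimensional ℝ E]
  [MeasurableSpace E] [BorelSpace E]

theorem integrable_of_continuous_of_isCompact {Y F : Type*} [TopologicalSpace Y] [T2Space Y]
    [MeasurableSpace Y] [BorelSpace Y] [SecondCountableTopology Y] [NormedAddCommGroup F]
    {ν : Measure Y} [IsFiniteMeasure ν] {X : Set Y} (hX : IsCompact X) (hν : ν Xᶜ = 0)
    {f : Y → F} (hf : Continuous f) : Integrable f ν := by
  have h : IntegrableOn f X ν := hf.continuousOn.integrableOn_compact hX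
  rwa [IntegrableOn, Measure.restrict_eq_self_of_ae_mem (mem_ae_iff.2 hν)] at h

/-- Weak duality for a pair of laws in convex order. -/
theorem integral_add_integral_nonneg_of_convexOrder
    {X₂ X₃ : Set E} (hX₂ : IsCompact X₂) (hX₃ : IsCompact X₃)
    {ν₂ ν₃ : Measure E} [IsProbabilityMeasure ν₂] [IsProbabilityMeasure ν₃]
    (h₂ : ν₂ X₂ᶜ = 0) (h₃ : ν₃ X₃ᶜ = 0)
    (hν : ∀ φ : E → ℝ, ConvexOn ℝ Set.univ φ → ∫ x, φ x ∂ν₂ ≤ ∫ x, φ x ∂ν₃)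
    {a h : E → ℝ} {g : E → E} (ha : Continuous a) (hh : Continuous h) (hg : Continuous g)
    (hnn : ∀ y ∈ X₂, ∀ z ∈ X₃, 0 ≤ a y + h z + ⟪g y, z - y⟫) :
    0 ≤ ∫ y, a y ∂ν₂ + ∫ z, h z ∂ν₃ := by
  have hne : X₂.Nonempty := by
    rw [Set.nonempty_iff_ne_empty]
    rintro rfl
    simp at h₂
  have : Nonempty X₂ := hne.to_subtype
  -- Convex, with `-a ≤ Φ` on `X₂` (take `y = z`) and `Φ ≤ h` on `X₃` (by `hnn`).
  let Φ : E → ℝ := fun z => ⨆ y : X₂, -(a y + ⟪g y, z - y⟫)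
  have hbdd : ∀ z, BddAbove (Set.range fun y : X₂ => -(a y + ⟪g y, z - (y : E)⟫)) := by
    intro z
    have : BddAbove ((fun y => -(a y + ⟪g y, z - y⟫)) '' X₂) :=
      hX₂.bddAbove_image (by fun_prop)
    rwa [Set.image_eq_range] at this
  have hΦ : ConvexOn ℝ Set.univ Φ := by
    refine ⟨convex_univ, fun z _ w _ s t hs ht hst => ciSup_le fun y => ?_⟩
    have hz := le_ciSup (hbdd z) y
    have hw := le_ciSup (hbdd w) y
    have e : s • z + t • w - (y : E) = s • (z - y) + t • (w - y) := by
      have : (y : E) = (s + t) • (y : E) := by rw [hst, one_smul]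
      rw [smul_sub, smul_sub, sub_add_sub_comm, ← add_smul, ← this]
    rw [e, inner_add_right, inner_smul_right, inner_smul_right]
    have e2 : -(a y + (s * ⟪g y, z - (y : E)⟫ + t * ⟪g y, w - (y : E)⟫))
        = s * -(a y + ⟪g y, z - (y : E)⟫) + t * -(a y + ⟪g y, w - (y : E)⟫) := by
      linear_combination (hst) * a y
    rw [e2, smul_eq_mul, smul_eq_mul]
    exact add_le_add (mul_le_mul_of_nonneg_left hz hs) (mul_le_mul_of_nonneg_left hw ht)
  have hΦc : Continuous Φ := hΦ.locallyLipschitz.continuous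
  have h1 : ∫ y, -a y ∂ν₂ ≤ ∫ y, Φ y ∂ν₂ := by
    refine integral_mono_ae (integrable_of_continuous_of_isCompact hX₂ h₂ ha.neg)
      (integrable_of_continuous_of_isCompact hX₂ h₂ hΦc) ?_
    filter_upwards [mem_ae_iff.2 h₂] with y hy
    refine le_trans (le_of_eq ?_) (le_ciSup (hbdd y) ⟨y, hy⟩)
    simp
  have h2 : ∫ z, Φ z ∂ν₃ ≤ ∫ z, h z ∂ν₃ := by
    refine integral_mono_ae (integrable_of_continuous_of_isCompact hX₃ h₃ hΦc)
      (integrable_of_continuous_of_isCompact hX₃ h₃ hh) ?_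
    filter_upwards [mem_ae_iff.2 h₃] with z hz
    refine ciSup_le fun y => ?_
    linarith [hnn y y.2 z hz]
  rw [integral_neg] at h1
  linarith [hν Φ hΦ]

/-- If `x - f(p)` is orthogonal to all test functions of `p` under `ρ`, then `ρ`'s conditional
means are given by `f`. -/
theorem exists_condKernel_integral_eq {P : Type*} [NormedAddCommGroup P] [NormedSpace ℝ P]
    [FiniteDimensional ℝ P] [MeasurableSpace P] [BorelSpace P]
    (ρ : Measure (P × E)) [IsFiniteMeasure ρ] {f : P → E}
    (hi : Integrable (fun q : P × E => q.2) ρ) (hfi : Integrable (fun q : P × E => f q.1) ρ)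
    (horth : ∀ (φ : P → ℝ), Continuous φ → HasCompactSupport φ →
      ∫ q : P × E, φ q.1 • (q.2 - f q.1) ∂ρ = 0) :
    ∃ η : Kernel P E, IsMarkovKernel η ∧ ρ = ρ.fst ⊗ₘ η ∧
      ∀ᵐ p ∂ρ.fst, Integrable (fun x => x) (η p) ∧ ∫ x, x ∂(η p) = f p := by
  have hdis : ρ.fst ⊗ₘ ρ.condKernel = ρ := ρ.disintegrate ρ.condKernel
  have hsub : Integrable (fun q : P × E => q.2 - f q.1) (ρ.fst ⊗ₘ ρ.condKernel) := by
    rw [hdis]; exact hi.sub hfi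
  have hi' : Integrable (fun q : P × E => q.2) (ρ.fst ⊗ₘ ρ.condKernel) := by rwa [hdis]
  have hae : ∀ᵐ p ∂ρ.fst, Integrable (fun x => x) (ρ.condKernel p) :=
    ((Measure.integrable_compProd_iff hi'.aestronglyMeasurable).1 hi').1
  refine ⟨ρ.condKernel, inferInstance, hdis.symm, ?_⟩
  have hm : Integrable (fun p => ∫ x, (x - f p) ∂(ρ.condKernel p)) ρ.fst := by
    have := Integrable.integral_compProd (κ := Kernel.const Unit ρ.fst)
      (η := Kernel.prodMkLeft Unit ρ.condKernel) (a := ()) hsub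
    simpa using this
  have hz : ∀ᵐ p ∂ρ.fst, ∫ x, (x - f p) ∂(ρ.condKernel p) = 0 := by
    refine ae_eq_zero_of_integral_contDiff_smul_eq_zero hm.locallyIntegrable fun φ hφ hφc => ?_
    rw [← horth φ hφ.continuous hφc]
    conv_rhs => rw [← hdis]
    obtain ⟨C, hC⟩ := hφc.exists_bound_of_continuous hφ.continuous
    rw [Measure.integral_compProd]
    · simp_rw [integral_smul]
    · exact hsub.bdd_smul C ((hφ.continuous.comp continuous_fst).aestronglyMeasurable)
        (Filter.Eventually.of_forall fun q => hC q.1)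
  filter_upwards [hae, hz] with p hp h0
  refine ⟨hp, ?_⟩
  rw [integral_sub hp (integrable_const _)] at h0
  simpa [sub_eq_zero] using h0

/-- Gluing of two kernels in convex order along their common first marginal, with a martingale
transition from the first kernel to the second. -/
theorem exists_measure_proj_eq_of_convexOrder
    {X₁ X₂ X₃ : Set E} (hX₁ : IsCompact X₁) (hX₂ : IsCompact X₂) (hX₃ : IsCompact X₃)
    {μ : Measure E} [IsProbabilityMeasure μ] {κ₂ κ₃ : Kernel E E}
    [IsMarkovKernel κ₂] [IsMarkovKernel κ₃] (h₁ : ∀ᵐ x ∂μ, x ∈ X₁)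
    (h₂ : ∀ᵐ x ∂μ, κ₂ x X₂ᶜ = 0) (h₃ : ∀ᵐ x ∂μ, κ₃ x X₃ᶜ = 0)
    (hκ : ∀ᵐ x ∂μ, ∀ φ : E → ℝ, ConvexOn ℝ Set.univ φ → ∫ y, φ y ∂(κ₂ x) ≤ ∫ y, φ y ∂(κ₃ x)) :
    ∃ π : Measure (E × E × E), IsProbabilityMeasure π ∧ π (X₁ ×ˢ X₂ ×ˢ X₃)ᶜ = 0 ∧
      π.map (fun x => (x.1, x.2.1)) = μ ⊗ₘ κ₂ ∧ π.map (fun x => (x.1, x.2.2)) = μ ⊗ₘ κ₃ ∧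
      ∀ φ : E × E → ℝ, Continuous φ → HasCompactSupport φ →
        ∫ x, φ (x.1, x.2.1) • (x.2.2 - x.2.1) ∂π = 0 := by
  have hK : IsCompact (X₁ ×ˢ X₂ ×ˢ X₃) := hX₁.prod (hX₂.prod hX₃)
  let K := (X₁ ×ˢ X₂ ×ˢ X₃ : Set (E × E × E))
  have : CompactSpace K := isCompact_iff_compactSpace.1 hK
  -- The first two terms fix the two marginals; the third, ignored by `L` below, must integrate to
  -- zero and so encodes the martingale condition.
  let F : ((E × E) →ᵇ ℝ) × ((E × E) →ᵇ ℝ) × ((E × E) →ᵇ E) → E × E × E → ℝ := fun v x =>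
    v.1 (x.1, x.2.1) + v.2.1 (x.1, x.2.2) + ⟪v.2.2 (x.1, x.2.1), x.2.2 - x.2.1⟫
  have hF : ∀ v, Continuous (F v) := fun v => by fun_prop
  let T : (((E × E) →ᵇ ℝ) × ((E × E) →ᵇ ℝ) × ((E × E) →ᵇ E)) →ₗ[ℝ] C(K, ℝ) :=
    { toFun := fun v => ⟨fun x => F v x, (hF v).comp continuous_subtype_val⟩
      map_add' := fun v w => by
        ext x
        simp only [F, Prod.fst_add, Prod.snd_add, BoundedContinuousFunction.coe_add, Pi.add_apply,
          inner_add_left, ContinuousMap.add_apply, ContinuousMap.coe_mk]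
        ring
      map_smul' := fun c v => by
        ext x
        simp only [F, Prod.smul_fst, Prod.smul_snd, BoundedContinuousFunction.coe_smul,
          real_inner_smul_left, ContinuousMap.smul_apply, ContinuousMap.coe_mk, smul_eq_mul,
          RingHom.id_apply]
        ring }
  let L : (((E × E) →ᵇ ℝ) × ((E × E) →ᵇ ℝ) × ((E × E) →ᵇ E)) →ₗ[ℝ] ℝ :=
    { toFun := fun v => ∫ p, v.1 p ∂(μ ⊗ₘ κ₂) + ∫ p, v.2.1 p ∂(μ ⊗ₘ κ₃)
      map_add' := fun v w => by
        simp only [Prod.fst_add, Prod.snd_add, BoundedContinuousFunction.coe_add, Pi.add_apply]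
        rw [integral_add (v.1.integrable _) (w.1.integrable _),
          integral_add (v.2.1.integrable _) (w.2.1.integrable _)]
        ring
      map_smul' := fun c v => by
        simp only [Prod.smul_fst, Prod.smul_snd, BoundedContinuousFunction.coe_smul,
          integral_smul, RingHom.id_apply, smul_add] }
  obtain ⟨m, hm, hmL⟩ := exists_measure_integral_eq T L (1, 0, 0) (fun x => by simp [T, F]) (by
    intro v hv
    have i₂ : Integrable v.1 (μ ⊗ₘ κ₂) := v.1.integrable _
    have i₃ : Integrable v.2.1 (μ ⊗ₘ κ₃) := v.2.1.integrable _
    change 0 ≤ ∫ p, v.1 p ∂(μ ⊗ₘ κ₂) + ∫ p, v.2.1 p ∂(μ ⊗ₘ κ₃)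
    have j₂ : Integrable (fun x => ∫ y, v.1 (x, y) ∂(κ₂ x)) μ := by
      have := Integrable.integral_compProd (κ := Kernel.const Unit μ)
        (η := Kernel.prodMkLeft Unit κ₂) (a := ()) i₂
      simpa using this
    have j₃ : Integrable (fun x => ∫ y, v.2.1 (x, y) ∂(κ₃ x)) μ := by
      have := Integrable.integral_compProd (κ := Kernel.const Unit μ)
        (η := Kernel.prodMkLeft Unit κ₃) (a := ()) i₃
      simpa using this
    rw [Measure.integral_compProd i₂, Measure.integral_compProd i₃, ← integral_add j₂ j₃]
    refine integral_nonneg_of_ae ?_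
    filter_upwards [h₁, h₂, h₃, hκ] with x hx₁ hx₂ hx₃ hx
    refine integral_add_integral_nonneg_of_convexOrder (g := fun y => v.2.2 (x, y))
      hX₂ hX₃ hx₂ hx₃ hx (by fun_prop) (by fun_prop) (by fun_prop) fun y hy z hz => ?_
    exact hv ⟨(x, y, z), hx₁, hy, hz⟩)
  let π : Measure (E × E × E) := m.map Subtype.val
  have hπL : ∀ v, ∫ x, F v x ∂π = ∫ p, v.1 p ∂(μ ⊗ₘ κ₂) + ∫ p, v.2.1 p ∂(μ ⊗ₘ κ₃) := by
    intro v
    rw [integral_map measurable_subtype_coe.aemeasurable (hF v).aestronglyMeasurable]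
    exact hmL v
  have hπfin : IsFiniteMeasure π := inferInstance
  have hπ₁₂ : π.map (fun x => (x.1, x.2.1)) = μ ⊗ₘ κ₂ := by
    refine ext_of_forall_integral_eq_of_IsFiniteMeasure fun u => ?_
    rw [integral_map (by fun_prop) (by fun_prop)]
    simpa [F] using hπL (u, 0, 0)
  have hπ₁₃ : π.map (fun x => (x.1, x.2.2)) = μ ⊗ₘ κ₃ := by
    refine ext_of_forall_integral_eq_of_IsFiniteMeasure fun u => ?_
    rw [integral_map (by fun_prop) (by fun_prop)]
    simpa [F] using hπL (0, u, 0)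
  have hπK : π (X₁ ×ˢ X₂ ×ˢ X₃)ᶜ = 0 := by
    rw [Measure.map_apply measurable_subtype_coe hK.measurableSet.compl]
    have : (Subtype.val : K → E × E × E) ⁻¹' (X₁ ×ˢ X₂ ×ˢ X₃)ᶜ = ∅ :=
      Set.eq_empty_of_forall_notMem fun x hx => hx x.2
    rw [this, measure_empty]
  refine ⟨π, ?_, hπK, hπ₁₂, hπ₁₃, fun φ hφ hφc => ?_⟩
  · have : IsProbabilityMeasure (π.map (fun x => (x.1, x.2.1))) := by rw [hπ₁₂]; infer_instance
    exact Measure.isProbabilityMeasure_of_map (fun x : E × E × E => (x.1, x.2.1))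
  · have hi : Integrable (fun x : E × E × E => φ (x.1, x.2.1) • (x.2.2 - x.2.1)) π :=
      integrable_of_continuous_of_isCompact hK hπK (by fun_prop)
    -- Pairing with a fixed `e` turns the vector identity into the constraint for `g = φ • e`.
    refine ext_inner_left ℝ fun e => ?_
    rw [← integral_inner hi, inner_zero_right]
    obtain ⟨C, hC⟩ := hφc.exists_bound_of_continuous hφ
    let u : (E × E) →ᵇ E := BoundedContinuousFunction.ofNormedAddCommGroup (fun p => φ p • e)
      (by fun_prop) (C * ‖e‖) fun p => by
        rw [norm_smul]
        exact mul_le_mul_of_nonneg_right (hC p) (norm_nonneg e)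
    have := hπL (0, 0, u)
    simpa [F, u, real_inner_smul_left, inner_smul_right] using this

end MartingaleOT

theorem mainTheorem11 (d : ℕ)
    (X₁ X₂ X₃ : Set (MartingaleOT.Rd d))
    (hX₁ : IsCompact X₁) (hX₂ : IsCompact X₂) (hX₃ : IsCompact X₃)
    (μ₁ μ₂ μ₃ : Measure (MartingaleOT.Rd d))
    [IsProbabilityMeasure μ₁] [IsProbabilityMeasure μ₂] [IsProbabilityMeasure μ₃]
    (hμ₁ : μ₁ X₁ᶜ = 0) (hμ₂ : μ₂ X₂ᶜ = 0) (hμ₃ : μ₃ X₃ᶜ = 0)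
    (h₁₂ : MartingaleOT.ConvexOrder μ₁ μ₂) (h₂₃ : MartingaleOT.ConvexOrder μ₂ μ₃)
    (κ₂ κ₃ : Kernel (MartingaleOT.Rd d) (MartingaleOT.Rd d))
    [IsMarkovKernel κ₂] [IsMarkovKernel κ₃]
    (π₁₂ π₁₃ : Measure (MartingaleOT.Rd d × MartingaleOT.Rd d))
    (hκ₂ : π₁₂ = μ₁ ⊗ₘ κ₂) (hκ₃ : π₁₃ = μ₁ ⊗ₘ κ₃)
    (hπ₁₂ : MartingaleOT.IsMartingaleCoupling₂ μ₁ μ₂ π₁₂)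
    (hπ₁₃ : MartingaleOT.IsMartingaleCoupling₂ μ₁ μ₃ π₁₃)
    (hκ : ∀ᵐ x₁ ∂μ₁, MartingaleOT.ConvexOrder (κ₂ x₁) (κ₃ x₁)) :
    ∃ π₁₂₃ : Measure (MartingaleOT.Rd d × MartingaleOT.Rd d × MartingaleOT.Rd d),
      MartingaleOT.IsMartingaleCoupling₃ μ₁ μ₂ μ₃ π₁₂₃ ∧
      MartingaleOT.proj12 π₁₂₃ = π₁₂ ∧ MartingaleOT.proj13 π₁₂₃ = π₁₃ := by
  obtain ⟨⟨hm₁, hm₂⟩, κ, hκM, hκπ, hκmean⟩ := hπ₁₂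
  obtain ⟨⟨-, hm₃⟩, -⟩ := hπ₁₃
  have hsupp : ∀ (X : Set (MartingaleOT.Rd d)) (ν : Measure (MartingaleOT.Rd d))
      (k : Kernel (MartingaleOT.Rd d) (MartingaleOT.Rd d)) [IsMarkovKernel k], IsCompact X →
      ν Xᶜ = 0 → (μ₁ ⊗ₘ k).map (fun x => x.2) = ν → ∀ᵐ x ∂μ₁, k x Xᶜ = 0 := by
    intro X ν k _ hX hν hmap
    rw [← hmap] at hν
    have h : ∀ᵐ p ∂(μ₁ ⊗ₘ k), p.2 ∈ X :=
      ae_of_ae_map measurable_snd.aemeasurable (mem_ae_iff.2 hν)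
    filter_upwards [Measure.ae_ae_of_ae_compProd h] with x hx using mem_ae_iff.1 hx
  obtain ⟨π, hπP, hπK, hp12, hp13, horth⟩ :=
    MartingaleOT.exists_measure_proj_eq_of_convexOrder hX₁ hX₂ hX₃ (mem_ae_iff.2 hμ₁)
      (hsupp X₂ μ₂ κ₂ hX₂ hμ₂ (hκ₂ ▸ hm₂)) (hsupp X₃ μ₃ κ₃ hX₃ hμ₃ (hκ₃ ▸ hm₃)) hκ
  rw [← hκ₂] at hp12
  rw [← hκ₃] at hp13
  have hK := hX₁.prod (hX₂.prod hX₃)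
  have hπ1 : π.map (fun x => x.1) = μ₁ := by
    rw [← hm₁, ← hp12, Measure.map_map (by fun_prop) (by fun_prop)]; rfl
  refine ⟨π, ⟨⟨hπ1, ?_, ?_⟩, ⟨π.condKernel, inferInstance, ?_, ?_⟩, ?_⟩, hp12, hp13⟩
  · rw [← hm₂, ← hp12, Measure.map_map (by fun_prop) (by fun_prop)]; rfl
  · rw [← hm₃, ← hp13, Measure.map_map (by fun_prop) (by fun_prop)]; rfl
  · rw [← hπ1]
    exact (π.disintegrate π.condKernel).symm
  · have hfst : π.fst = μ₁ := hπ1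
    have hdis : μ₁ ⊗ₘ π.condKernel = π := by
      rw [← hfst]; exact π.disintegrate π.condKernel
    -- Both sides are `π₁₂`, so a.e. uniqueness of disintegrations transfers the barycentre of `κ`.
    have hcomp : μ₁ ⊗ₘ (π.condKernel.map Prod.fst) = μ₁ ⊗ₘ κ := by
      rw [Measure.compProd_map measurable_fst, hdis, ← hκπ, ← hp12]
      rfl
    have : IsMarkovKernel (π.condKernel.map (Prod.fst : MartingaleOT.Rd d × MartingaleOT.Rd d → _)) :=
      Kernel.IsMarkovKernel.map _ measurable_fst
    filter_upwards [Kernel.ae_eq_of_compProd_eq hcomp, hκmean] with x hx hmean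
    rw [← hx, Kernel.map_apply _ measurable_fst] at hmean
    rw [integrable_map_measure (by fun_prop) (by fun_prop),
      integral_map (by fun_prop) (by fun_prop)] at hmean
    exact hmean
  · let r : MartingaleOT.Rd d × MartingaleOT.Rd d × MartingaleOT.Rd d →
        (MartingaleOT.Rd d × MartingaleOT.Rd d) × MartingaleOT.Rd d := fun x => ((x.1, x.2.1), x.2.2)
    have hr : Measurable r := by fun_prop
    have hfst : (π.map r).fst = MartingaleOT.proj12 π := by
      rw [Measure.fst, Measure.map_map measurable_fst hr]; rfl
    have := MartingaleOT.exists_condKernel_integral_eq (π.map r) (f := Prod.snd)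
      ((integrable_map_measure (by fun_prop) hr.aemeasurable).2
        (MartingaleOT.integrable_of_continuous_of_isCompact hK hπK (by fun_prop)))
      ((integrable_map_measure (by fun_prop) hr.aemeasurable).2
        (MartingaleOT.integrable_of_continuous_of_isCompact hK hπK (by fun_prop)))
      (fun φ hφ hφc => by
        rw [integral_map hr.aemeasurable (by fun_prop)]
        exact horth φ hφ hφc)
    rwa [hfst] at this
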